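/- **Setting.** A clustered distributed storage system has $n=Ln_I$ places for storage nodes, in $L\ge 2$ clusters of $n_I\ge 2$ places each. A uniformly distributed file is encoded, possibly with randomization, into the contents of $n$ initial nodes. Active nodes fail one at a time, in an arbitrary infinite sequence. Each failed node is replaced, at its place and hence in its cluster, by a newcomer, which receives one message from each of the other $n-1$ active nodes and stores a function of these messages; a helper's message is a function of what the helper stores (both functions may depend on the failures so far). Every node has storage size $\alpha\ge 0$. A message has size at most $\beta_I=\gamma_I/(n_I-1)$ if the helper is in the cluster of the newcomer, and at most $\beta_c=\gamma_c/(n-n_I)$ otherwise, so that $\gamma_I,\gamma_c\ge 0$ are the overall intra-cluster and cross-cluster repair bandwidths. Whatever the failures, at every time the file must be recoverable without error from the contents of any $k$ active nodes, where $1\le k<n$. An eavesdropper picks at most $l$ nodes (initial nodes or newcomers) that lie in at most $L_c$ clusters, and reads what these nodes store and, for newcomers, all messages they receive. Here $1\le L_c\le L$, $0\le l\le k$ and $l\le n_IL_c$. The code is perfectly secret if, for every sequence of failures and every such choice of nodes, what is read is independent of the file. The secrecy capacity $C_s(\alpha,\gamma_I,\gamma_c)$ is the supremum of the file sizes of perfectly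 secret codes. (The size of a quantity that takes $N$ values is $\log_2 N/u$, where the unit of information, $u>0$ bits, is chosen with the code.) **Theorem.** Put $q=\lfloor k/n_I\rfloor$, $r=k \bmod n_I$ and $l'=l-r(q+1)$. Then $$C_s(\alpha,\gamma_I,\gamma_c)\le\sum_{i=1}^{n_I}\ \sum_{j=f(i)+1}^{g(i)}\min\{x(i)\gamma_I+y^*(i,j)\gamma_c,\ \alpha\},$$ where $$g(i)=\begin{cases}q+1,& i\le r\\ q,&\text{otherwise,}\end{cases}\qquad x(i)=\frac{n_I-i}{n_I-1},$$ $$y^*(i,j)=1-\frac{(l-i)+\sum_{m=1}^{i-1}\bigl(g(m)-f(m)\bigr)+j-f(i)}{n-n_I},$$ $$f=\begin{cases}f_1,& L_c\le q\\ f_2,& L_c>q,\ l\le r(q+1)\\ f_3,&\text{otherwise,}\end{cases}$$ $$f_1(i)=\begin{cases}L_c,& i\le\lfloor l/L_c\rfloor\\ l-L_c\lfloor l/L_c\rfloor,& i=\lfloor l/L_c\rfloor+1\\ 0,&\text{otherwise,}\end{cases}$$ $$f_2(i)=\begin{cases}g(i),& i\le\lfloor l/(q+1)\rfloor\\ l-(q+1)\lfloor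 l/(q+1)\rfloor,& i=\lfloor l/(q+1)\rfloor+1\\ 0,&\text{otherwise,}\end{cases}$$ $$f_3(i)=\begin{cases}g(i),& i\le\lfloor l'/q\rfloor+r\\ l'-q\lfloor l'/q\rfloor,& i=\lfloor l'/q\rfloor+r+1\\ 0,&\text{otherwise.}\end{cases}$$ (The function $f_3$ occurs only if $q\ge1$ and $l'\ge0$.) -/

import Mathlib

namespace ClusteredStorage

/-- A place for an active storage node: `(c, p)` is place `p` of cluster `c`. There are `L` clusters
of `nI` places each, `n = L * nI` in all. A newcomer takes the place of the node it replaces. -/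
abbrev Slot (L nI : ℕ) := Fin L × Fin nI

/-- The helpers of a repair are all the other `n - 1` active nodes. -/
abbrev Helper {L nI : ℕ} (failed : Slot L nI) := {s : Slot L nI // s ≠ failed}

/-- A code for the clustered storage system. A file, uniform on `Fin M`, is encoded (with arbitrary
randomization) into the contents of the `n` initial nodes. Nodes store an element of `Fin a`. A helper
sends an element of `Fin bI` inside its cluster and of `Fin bc` to another cluster. The
repair functions are arbitrary and may depend on the places that failed earlier
(listed in chronological order). -/
structure Code (L nI : ℕ) where
  /-- number of files -/
  M : ℕ
  /-- number of possible contents of a node -/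
  a : ℕ
  /-- number of possible intra-cluster repair messages -/
  bI : ℕ
  /-- number of possible cross-cluster repair messages -/
  bc : ℕ
  M_pos : 0 < M
  /-- law of the initial contents, given the file -/
  encode : Fin M → PMF (Slot L nI → Fin a)
  /-- message of a helper, as a function of what it stores -/
  send : List (Slot L nI) → (failed : Slot L nI) → (h : Helper failed) →
    Fin a → Fin (if h.1.1 = failed.1 then bI else bc)
  /-- content of the newcomer, as a function of the messages it receives -/
  rebuild : List (Slot L nI) → (failed : Slot L nI) →
    ((h : Helper failed) → Fin (if h.1.1 = failed.1 then bI else bc)) → Fin a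

/-- A storage node of a run in which the place `σ t` fails at time `t = 0, 1, 2, …`: `inl s` is the
initial node at place `s`, `inr t` is the newcomer that replaces the node failing at time `t`. -/
abbrev Node (L nI : ℕ) := Slot L nI ⊕ ℕ

/-- The cluster of a node. -/
def Node.cluster {L nI : ℕ} (σ : ℕ → Slot L nI) : Node L nI → Fin L
  | .inl s => s.1
  | .inr t => (σ t).1

/-- The places that fail before time `t`, in chronological order. -/
def history {L nI : ℕ} (σ : ℕ → Slot L nI) (t : ℕ) : List (Slot L nI) :=
  (List.range t).map σ

namespace Code

variable {L nI : ℕ} (C : Code L nI) (σ : ℕ → Slot L nI)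

/-- What a newcomer at place `failed` downloads: one message from each helper. -/
abbrev Download (failed : Slot L nI) :=
  (h : Helper failed) → Fin (if h.1.1 = failed.1 then C.bI else C.bc)

/-- The messages sent at time `t` when the active nodes hold `c`. -/
def messages (t : ℕ) (c : Slot L nI → Fin C.a) : C.Download (σ t) :=
  fun h => C.send (history σ t) (σ t) h (c h.1)

/-- The contents of the active nodes after the first `t` repairs, from the initial contents `x`. -/
def contents (x : Slot L nI → Fin C.a) : ℕ → Slot L nI → Fin C.a
  | 0 => x
  | t + 1 => Function.update (contents x t) (σ t)
      (C.rebuild (history σ t) (σ t) (C.messages σ t (contents x t)))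

/-- The kind of data an eavesdropper reads at a node: the stored data, and for a
newcomer also the downloaded data. -/
abbrev View : Node L nI → Type
  | .inl _ => Fin C.a
  | .inr t => C.Download (σ t) × Fin C.a

/-- The data an eavesdropper reads at a node. -/
def view (x : Slot L nI → Fin C.a) : (v : Node L nI) → C.View σ v
  | .inl s => x s
  | .inr t => (C.messages σ t (C.contents σ x t), C.contents σ x (t + 1) (σ t))

/-- Whatever the failures, a data collector that contacts any `k` active nodes at any time
recovers the file. -/
def Reconstructs (k : ℕ) : Prop :=
  ∀ (σ : ℕ → Slot L nI) (t : ℕ) (B : Finset (Slot L nI)), B.card = k →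
    ∃ decode : (B → Fin C.a) → Fin C.M, ∀ m, ∀ x ∈ (C.encode m).support,
      decode (fun s => C.contents σ x t s) = m

/-- Perfect secrecy: whatever the failures, what is read at at most `l` nodes (initial nodes or
newcomers) lying in at most `Lc` clusters has a law that does not depend on the file. -/
def Secure (l Lc : ℕ) : Prop :=
  ∀ (σ : ℕ → Slot L nI) (E : Finset (Node L nI)),
    E.card ≤ l → (E.image (Node.cluster σ)).card ≤ Lc →
    ∀ m m', (C.encode m).map (fun x (v : E) => C.view σ x v) =
      (C.encode m').map (fun x (v : E) => C.view σ x v)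

end Code

/-- The amount `R` of information can be stored securely: for some size `u > 0` (in bits) of a unit
of information there is a code with node size `α`, intra-cluster link size `γI / (nI - 1)`,
cross-cluster link size `γc / (n - nI)` and file size `R`, all measured in that unit. -/
def IsAchievable (L nI k l Lc : ℕ) (α γI γc R : ℝ) : Prop :=
  ∃ (C : Code L nI) (u : ℝ), 0 < u ∧
    Real.logb 2 C.a ≤ α * u ∧
    Real.logb 2 C.bI ≤ γI / ((nI : ℝ) - 1) * u ∧
    Real.logb 2 C.bc ≤ γc / ((L : ℝ) * nI - nI) * u ∧
    C.Reconstructs k ∧ C.Secure l Lc ∧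
    Real.logb 2 C.M = R * u

/-- The secrecy capacity, a supremum in the extended reals. -/
noncomputable def secrecyCapacity (L nI k l Lc : ℕ) (α γI γc : ℝ) : EReal :=
  ⨆ (R : ℝ) (_ : IsAchievable L nI k l Lc α γI γc R), (R : EReal)

/-! The functions in the bound; `/` and `%` on `ℕ` are quotient and remainder. -/

def g (nI k i : ℕ) : ℕ :=
  if i ≤ k % nI then k / nI + 1 else k / nI

def f₁ (l Lc i : ℕ) : ℕ :=
  if i ≤ l / Lc then Lc
  else if i = l / Lc + 1 then l - Lc * (l / Lc)
  else 0

def f₂ (nI k l i : ℕ) : ℕ :=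
  if i ≤ l / (k / nI + 1) then g nI k i
  else if i = l / (k / nI + 1) + 1 then l - (k / nI + 1) * (l / (k / nI + 1))
  else 0

/-- Used only when `k % nI * (k / nI + 1) < l`, so the subtraction does not truncate. -/
def l' (nI k l : ℕ) : ℕ := l - k % nI * (k / nI + 1)

def f₃ (nI k l i : ℕ) : ℕ :=
  if i ≤ l' nI k l / (k / nI) + k % nI then g nI k i
  else if i = l' nI k l / (k / nI) + k % nI + 1 then
    l' nI k l - k / nI * (l' nI k l / (k / nI))
  else 0

def f (nI k l Lc i : ℕ) : ℕ :=
  if Lc ≤ k / nI then f₁ l Lc i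
  else if l ≤ k % nI * (k / nI + 1) then f₂ nI k l i
  else f₃ nI k l i

noncomputable def x (nI i : ℕ) : ℝ := ((nI : ℝ) - i) / ((nI : ℝ) - 1)

noncomputable def yStar (L nI k l Lc i j : ℕ) : ℝ :=
  1 - (((l : ℝ) - i) +
      ((∑ m ∈ Finset.Icc 1 (i - 1), ((g nI k m : ℝ) - f nI k l Lc m)) + j - f nI k l Lc i)) /
    ((L : ℝ) * nI - nI)

end ClusteredStorage

namespace ClusteredStorage

open Finset

/-! ### Failure sequences in which prescribed slots fail exactly once -/

section Schedule

variable {L nI : ℕ}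

/-! A cut-set bound, proved by counting instead of entropy. Let the `k` slots under the graph of `g`
fail once each: first the `l` slots under `f`, then the others by place and, within a place, by
cluster. The eavesdropper reads the newcomers under `f`; the collector contacts all `k` newcomers.

Perfect secrecy makes the set of possible views the same for all files, so every file has initial
contents that yield one fixed view. With these contents, the file is determined by the `k - l`
unread newcomers. Each of them, given its predecessors, takes at most `min a (bI ^ A * bc ^ B)`
values, where `A` and `B` count the helpers inside and outside its cluster that are not yet
replaced. So the number of files is at most the product of these sizes (`card_files_le`).

As `f` and `g` are nonincreasing, the newcomer at place `i` of cluster `j` has `A = nI - i`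
(`freshIntra_band`) and `B = y*(i,j) (n - nI)` (`freshCross_add_band`, `sum_profile`). Logarithms
turn the product into the stated sum (`le_of_isAchievable`). The properties required of `f` and `g`
are checked in `f_spec` and `sum_g`. -/

theorem contents_succ_self (C : Code L nI) (σ : ℕ → Slot L nI) (x : Slot L nI → Fin C.a) (t : ℕ) :
    C.contents σ x (t + 1) (σ t) =
      C.rebuild (history σ t) (σ t) (C.messages σ t (C.contents σ x t)) :=
  Function.update_self ..

open Classical in
/-- The slots of `V` fail at the times given by `key`; at all other times `d` fails. -/
noncomputable def schedule (V : Finset (Slot L nI)) (key : Slot L nI → ℕ) (d : Slot L nI) (t : ℕ) :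
    Slot L nI :=
  if h : ∃ v ∈ V, key v = t then h.choose else d

variable {V : Finset (Slot L nI)} {key : Slot L nI → ℕ} {d : Slot L nI}

theorem schedule_key (hkey : Function.Injective key) {v : Slot L nI} (hv : v ∈ V) :
    schedule V key d (key v) = v := by
  have h : ∃ w ∈ V, key w = key v := ⟨v, hv, rfl⟩
  rw [schedule, dif_pos h]
  exact hkey h.choose_spec.2

theorem key_eq_of_schedule_eq (hd : d ∉ V) {v : Slot L nI} (hv : v ∈ V) {t : ℕ}
    (ht : schedule V key d t = v) : key v = t := by
  unfold schedule at ht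
  split_ifs at ht with h
  · exact ht ▸ h.choose_spec.2
  · exact absurd (ht ▸ hv) hd

/-- Since `d` lies outside `V`, a slot of `V` fails only at its own key, so its newcomer is never
replaced. -/
theorem contents_schedule_of_lt (C : Code L nI) (hd : d ∉ V) {v : Slot L nI} (hv : v ∈ V)
    (x : Slot L nI → Fin C.a) {t : ℕ} (ht : key v < t) :
    C.contents (schedule V key d) x t v = C.contents (schedule V key d) x (key v + 1) v := by
  induction t, ht using Nat.le_induction with
  | base => rfl
  | succ t ht ih =>
    rw [← ih, Code.contents, Function.update_of_ne]
    intro h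
    have := key_eq_of_schedule_eq hd hv h.symm
    omega

end Schedule

/-! ### Bounding the number of files by counting fresh messages -/

section Counting

variable {L nI : ℕ}

/-- The slots of `V` that have failed once `v` has. -/
def failedUpTo (V : Finset (Slot L nI)) (key : Slot L nI → ℕ) (v : Slot L nI) :
    Finset (Slot L nI) :=
  V.filter fun s => key s ≤ key v

/-- The number of messages into `v` from its own cluster that do not come from earlier newcomers. -/
def freshIntra (V : Finset (Slot L nI)) (key : Slot L nI → ℕ) (v : Slot L nI) : ℕ :=
  #{s : Slot L nI | s ∉ failedUpTo V key v ∧ s.1 = v.1}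

/-- The number of messages into `v` from other clusters that do not come from earlier newcomers. -/
def freshCross (V : Finset (Slot L nI)) (key : Slot L nI → ℕ) (v : Slot L nI) : ℕ :=
  #{s : Slot L nI | s ∉ failedUpTo V key v ∧ s.1 ≠ v.1}

/-- The number of contents of `v` that are possible when the earlier newcomers are known. -/
def freshSize (C : Code L nI) (V : Finset (Slot L nI)) (key : Slot L nI → ℕ) (v : Slot L nI) : ℕ :=
  min C.a (C.bI ^ freshIntra V key v * C.bc ^ freshCross V key v)

variable {V : Finset (Slot L nI)} {key : Slot L nI → ℕ} {d : Slot L nI}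

theorem card_fresh_messages (C : Code L nI) (v : Slot L nI) :
    Fintype.card ((s : {s : Slot L nI // s ∉ failedUpTo V key v}) →
      Fin (if s.1.1 = v.1 then C.bI else C.bc)) =
      C.bI ^ freshIntra V key v * C.bc ^ freshCross V key v := by
  rw [Fintype.card_pi]
  simp only [Fintype.card_fin]
  rw [← Finset.prod_subtype (univ.filter fun s => s ∉ failedUpTo V key v) (by simp)
    (fun s : Slot L nI => if s.1 = v.1 then C.bI else C.bc), Finset.prod_ite]
  simp [freshIntra, freshCross, Finset.filter_filter]

/-- Given the contents of the earlier newcomers, the content of the newcomer at `v` is determined by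
one of `freshSize` values. -/
theorem exists_fresh_label (C : Code L nI) (hkey : Function.Injective key) {v : Slot L nI}
    (hv : v ∈ V) :
    ∃ φ : (Slot L nI → Fin C.a) → Fin (freshSize C V key v), ∀ x x', φ x = φ x' →
      (∀ s ∈ V, key s < key v → C.contents (schedule V key d) x (key v) s =
        C.contents (schedule V key d) x' (key v) s) →
      C.contents (schedule V key d) x (key v + 1) v =
        C.contents (schedule V key d) x' (key v + 1) v := by
  have hσ : schedule V key d (key v) = v := schedule_key hkey hv
  rcases le_total C.a (C.bI ^ freshIntra V key v * C.bc ^ freshCross V key v) with h | h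
  · have e : freshSize C V key v = C.a := min_eq_left h
    refine ⟨fun x => (C.contents (schedule V key d) x (key v + 1) v).cast e.symm, ?_⟩
    intro x x' hx _
    simpa [Fin.ext_iff] using hx
  · have e : freshSize C V key v = Fintype.card
        ((s : {s : Slot L nI // s ∉ failedUpTo V key (schedule V key d (key v))}) →
          Fin (if s.1.1 = (schedule V key d (key v)).1 then C.bI else C.bc)) := by
      rw [card_fresh_messages, hσ]
      exact min_eq_right h
    have hself : schedule V key d (key v) ∈ failedUpTo V key (schedule V key d (key v)) := by
      rw [hσ]
      simp [failedUpTo, hv]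
    -- The label is the tuple of messages from helpers not yet replaced; all other messages are
    -- functions of earlier newcomers.
    let fresh (x : Slot L nI → Fin C.a)
        (s : {s : Slot L nI // s ∉ failedUpTo V key (schedule V key d (key v))}) :
        Fin (if s.1.1 = (schedule V key d (key v)).1 then C.bI else C.bc) :=
      C.messages (schedule V key d) (key v) (C.contents (schedule V key d) x (key v))
        ⟨s.1, fun hs => s.2 (by rw [hs]; exact hself)⟩
    refine ⟨fun x => (Fintype.equivFin _ (fresh x)).cast e.symm, ?_⟩
    intro x x' hx hprev
    have hx := (Fintype.equivFin _).injective (Fin.cast_injective _ hx)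
    have hmsg : C.messages (schedule V key d) (key v) (C.contents (schedule V key d) x (key v)) =
        C.messages (schedule V key d) (key v) (C.contents (schedule V key d) x' (key v)) := by
      funext s
      by_cases hs : s.1 ∈ failedUpTo V key (schedule V key d (key v))
      · have hs' := Finset.mem_filter.1 hs
        have hne : key s.1 ≠ key v := fun h => s.2 ((hkey h).trans hσ.symm)
        have hle : key s.1 ≤ key v := by simpa [hσ] using hs'.2
        rw [Code.messages, Code.messages, hprev s.1 hs'.1 (lt_of_le_of_ne hle hne)]
      · exact congrFun hx ⟨s.1, hs⟩
    have hstep : ∀ y, C.contents (schedule V key d) y (key v + 1) v =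
        C.rebuild (history (schedule V key d) (key v)) (schedule V key d (key v))
          (C.messages (schedule V key d) (key v) (C.contents (schedule V key d) y (key v))) :=
      fun y => (congrArg (C.contents _ y (key v + 1)) hσ.symm).trans
        (contents_succ_self C _ y (key v))
    rw [hstep, hstep, hmsg]

/-- Once the view of `E` is frozen, the labels of the newcomers in `V \ E` determine all contents of
`V` by induction on the failure time, hence the file. -/
theorem card_files_le (C : Code L nI) {k l Lc : ℕ} (hrec : C.Reconstructs k)
    (hsec : C.Secure l Lc) {E : Finset (Slot L nI)} (hkey : Function.Injective key)
    (hV : #V = k) (hd : d ∉ V) (hE : E ⊆ V) (hEl : #E ≤ l) (hELc : #(E.image Prod.fst) ≤ Lc) :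
    C.M ≤ ∏ v ∈ V \ E, freshSize C V key v := by
  set σ := schedule V key d with hσdef
  have hσ : ∀ v ∈ V, σ (key v) = v := fun v hv => schedule_key hkey hv
  set N : Finset (Node L nI) := E.image fun v => Sum.inr (key v) with hN
  have hsec' := hsec σ N (card_image_le.trans hEl) (by
    rw [hN, Finset.image_image]
    refine le_trans (le_of_eq ?_) hELc
    congr 1
    refine Finset.image_congr fun v hv => ?_
    simp [Node.cluster, hσ v (hE hv)])
  obtain ⟨x₀, hx₀⟩ := (C.encode ⟨0, C.M_pos⟩).support_nonempty
  -- Equal laws have equal supports, so the view produced by `x₀` is possible for every file.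
  have hex : ∀ m, ∃ x ∈ (C.encode m).support,
      (fun v : N => C.view σ x v) = fun v : N => C.view σ x₀ v := by
    intro m
    have hmem : (fun v : N => C.view σ x₀ v) ∈
        ((C.encode ⟨0, C.M_pos⟩).map fun x (v : N) => C.view σ x v).support := by
      rw [PMF.support_map]
      exact ⟨x₀, hx₀, rfl⟩
    rw [hsec' _ m, PMF.support_map] at hmem
    exact hmem
  choose X hX hview using hex
  choose φ hφ using fun (v : Slot L nI) (hv : v ∈ V) =>
    exists_fresh_label (d := d) C hkey hv
  let Φ : Fin C.M → (v : {v // v ∈ V \ E}) → Fin (freshSize C V key v) :=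
    fun m v => φ v (mem_sdiff.1 v.2).1 (X m)
  have hΦ : Function.Injective Φ := by
    intro m m' hmm
    have hcont : ∀ n, ∀ v ∈ V, key v = n → C.contents σ (X m) (key v + 1) v =
        C.contents σ (X m') (key v + 1) v := by
      intro n
      induction n using Nat.strong_induction_on with
      | _ n ih =>
        intro v hv hvn
        by_cases hvE : v ∈ E
        · have h : Sum.inr (key v) ∈ N := mem_image_of_mem _ hvE
          have h1 := congrArg Prod.snd
            (congrFun ((hview m).trans (hview m').symm) ⟨Sum.inr (key v), h⟩)
          simp only [Code.view] at h1
          rwa [hσ v hv] at h1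
        · refine hφ v hv _ _ (congrFun hmm ⟨v, mem_sdiff.2 ⟨hv, hvE⟩⟩) fun s hs hlt => ?_
          rw [contents_schedule_of_lt C hd hs _ hlt, contents_schedule_of_lt C hd hs _ hlt]
          exact ih (key s) (hvn ▸ hlt) s hs rfl
    -- At this time every slot of `V` has been replaced.
    obtain ⟨dec, hdec⟩ := hrec σ (V.sup key + 1) V hV
    rw [← hdec m _ (hX m), ← hdec m' _ (hX m')]
    congr 1
    funext s
    have hlt : key s.1 < V.sup key + 1 := Nat.lt_succ_of_le (Finset.le_sup s.2)
    rw [contents_schedule_of_lt C hd s.2 _ hlt, contents_schedule_of_lt C hd s.2 _ hlt]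
    exact hcont _ _ s.2 rfl
  have := Fintype.card_le_of_injective Φ hΦ
  rw [Fintype.card_fin, Fintype.card_pi] at this
  simp only [Fintype.card_fin] at this
  rwa [Finset.prod_coe_sort (V \ E) (fun v => freshSize C V key v)] at this

end Counting

/-! ### Regions under nonincreasing functions, and their fresh message counts -/

section Young

variable {L nI : ℕ}

/-- The slots whose (one-based) cluster index lies above `lo` and at most at `hi`, where
the bounds depend on the (one-based) place. -/
def band (L nI : ℕ) (lo hi : ℕ → ℕ) : Finset (Slot L nI) :=
  univ.filter fun s => lo (s.2 + 1) ≤ s.1 ∧ (s.1 : ℕ) < hi (s.2 + 1)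

theorem mem_band {lo hi : ℕ → ℕ} {s : Slot L nI} :
    s ∈ band L nI lo hi ↔ lo (s.2 + 1) ≤ s.1 ∧ (s.1 : ℕ) < hi (s.2 + 1) := by
  simp [band]

theorem sum_Icc_one_eq_sum_fin {A : Type*} [AddCommMonoid A] (n : ℕ) (F : ℕ → A) :
    ∑ i ∈ Icc 1 n, F i = ∑ p : Fin n, F (p + 1) := by
  rw [Fin.sum_univ_eq_sum_range (fun p => F (p + 1)) n, Finset.range_eq_Ico,
    Finset.sum_Ico_add' F 0 n 1]
  rfl

theorem sum_band {A : Type*} [AddCommMonoid A] {lo hi : ℕ → ℕ}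
    (hhi : ∀ i ∈ Icc 1 nI, hi i ≤ L) (F : ℕ → ℕ → A) :
    ∑ s ∈ band L nI lo hi, F (s.2 + 1) (s.1 + 1) =
      ∑ i ∈ Icc 1 nI, ∑ j ∈ Icc (lo i + 1) (hi i), F i j := by
  rw [sum_Icc_one_eq_sum_fin, band, Finset.sum_filter, ← Finset.univ_product_univ,
    Finset.sum_product_right]
  refine Finset.sum_congr rfl fun p _ => ?_
  have hp : hi (p + 1) ≤ L := hhi _ (by simp)
  have hset : Icc (lo (p + 1) + 1) (hi (p + 1)) =
      (Icc 1 L).filter fun j => lo (p + 1) + 1 ≤ j ∧ j ≤ hi (p + 1) := by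
    ext j
    simp only [mem_Icc, mem_filter]
    omega
  rw [hset, Finset.sum_filter, sum_Icc_one_eq_sum_fin]
  refine Finset.sum_congr rfl fun c _ => ?_
  exact if_congr (by dsimp only; omega) rfl rfl

theorem card_band {lo hi : ℕ → ℕ} (hhi : ∀ i ∈ Icc 1 nI, hi i ≤ L) :
    #(band L nI lo hi) = ∑ i ∈ Icc 1 nI, (hi i - lo i) := by
  rw [Finset.card_eq_sum_ones]
  refine (sum_band hhi fun _ _ => 1).trans (Finset.sum_congr rfl fun i _ => ?_)
  simp

/-- Slots below `f` come first; otherwise the slots are ordered by place, then by cluster. -/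
def rowKey (L nI : ℕ) (f : ℕ → ℕ) (s : Slot L nI) : ℕ :=
  (if (s.1 : ℕ) < f (s.2 + 1) then 0 else L * nI) + (s.1 + L * s.2)

theorem row_lt (s : Slot L nI) : (s.1 : ℕ) + L * s.2 < L * nI := by
  have h1 : L * ((s.2 : ℕ) + 1) ≤ L * nI := Nat.mul_le_mul_left _ s.2.2
  have := s.1.2
  rw [mul_add] at h1
  omega

theorem row_le_iff (s v : Slot L nI) : (s.1 : ℕ) + L * s.2 ≤ v.1 + L * v.2 ↔
    (s.2 : ℕ) < v.2 ∨ (s.2 : ℕ) = v.2 ∧ (s.1 : ℕ) ≤ v.1 := by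
  have hs := s.1.2
  have hv := v.1.2
  rcases lt_trichotomy (s.2 : ℕ) v.2 with h | h | h
  · have h1 : L * ((s.2 : ℕ) + 1) ≤ L * v.2 := Nat.mul_le_mul_left _ h
    rw [mul_add] at h1
    omega
  · rw [h]
    omega
  · have h1 : L * ((v.2 : ℕ) + 1) ≤ L * s.2 := Nat.mul_le_mul_left _ h
    rw [mul_add] at h1
    omega

theorem rowKey_injective (f : ℕ → ℕ) : Function.Injective (rowKey L nI f) := by
  intro s v h
  have hs := row_lt s
  have hv := row_lt v
  have e : (s.1 : ℕ) + L * s.2 = v.1 + L * v.2 := by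
    unfold rowKey at h
    split_ifs at h <;> omega
  have h1 := (row_le_iff s v).1 e.le
  have h2 := (row_le_iff v s).1 e.ge
  ext <;> omega

variable {f g : ℕ → ℕ}

/-- The slots that fail up to and including `v`, as the region below a function of the place. -/
def profile (f g : ℕ → ℕ) (v : Slot L nI) (i : ℕ) : ℕ :=
  if i ≤ v.2 then g i else if i = v.2 + 1 then v.1 + 1 else f i

theorem failedUpTo_band (hfg : ∀ i ∈ Icc 1 nI, f i ≤ g i) {v : Slot L nI}
    (hv : v ∈ band L nI f g) :
    failedUpTo (band L nI 0 g) (rowKey L nI f) v = band L nI 0 (profile f g v) := by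
  ext s
  rw [mem_band] at hv
  have hs := row_lt s
  have hle := row_le_iff s v
  have h := hfg (s.2 + 1) (by simp)
  simp only [failedUpTo, mem_filter, mem_band, Pi.zero_apply, zero_le, true_and, rowKey, profile,
    if_neg (not_lt.2 hv.1)]
  by_cases h1 : (s.2 : ℕ) = v.2
  · rw [← h1] at hv ⊢
    split_ifs <;> omega
  · split_ifs <;> omega

theorem profile_le (hgL : ∀ i ∈ Icc 1 nI, g i ≤ L) (hfg : ∀ i ∈ Icc 1 nI, f i ≤ g i)
    (v : Slot L nI) : ∀ i ∈ Icc 1 nI, profile f g v i ≤ L := by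
  intro i hi
  have := hgL i hi
  have := hfg i hi
  unfold profile
  split_ifs <;> omega

/-- Monotonicity enters here: at places up to that of `v` the function `g` still exceeds the cluster
index of `v`, and at later places `f` does not. So the failed slots in the cluster of `v` form an
initial segment. -/
theorem profile_iff_same_cluster (hg : AntitoneOn g (Set.Icc 1 nI))
    (hf : AntitoneOn f (Set.Icc 1 nI)) {v : Slot L nI} (hv : v ∈ band L nI f g) (p : Fin nI) :
    (v.1 : ℕ) < profile f g v (p + 1) ↔ p ≤ v.2 := by
  rw [mem_band] at hv
  have hmem : ∀ p : Fin nI, (p : ℕ) + 1 ∈ Set.Icc 1 nI := fun p => ⟨by omega, p.2⟩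
  rcases le_total p v.2 with h | h
  · have := hg (hmem p) (hmem v.2) (by simpa using h)
    unfold profile
    rw [Fin.le_def] at *
    split_ifs <;> omega
  · have := hf (hmem v.2) (hmem p) (by simpa using h)
    unfold profile
    rw [Fin.le_def] at *
    split_ifs <;> omega

theorem freshIntra_band (hfg : ∀ i ∈ Icc 1 nI, f i ≤ g i)
    (hg : AntitoneOn g (Set.Icc 1 nI)) (hf : AntitoneOn f (Set.Icc 1 nI)) {v : Slot L nI}
    (hv : v ∈ band L nI f g) :
    freshIntra (band L nI 0 g) (rowKey L nI f) v = nI - (v.2 + 1) := by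
  have : (univ.filter fun s : Slot L nI =>
      s ∉ failedUpTo (band L nI 0 g) (rowKey L nI f) v ∧ s.1 = v.1) =
      {v.1} ×ˢ Ioi v.2 := by
    ext ⟨c, p⟩
    rw [failedUpTo_band hfg hv]
    simp only [mem_filter, mem_univ, true_and, mem_band, Pi.zero_apply, zero_le, mem_product,
      mem_singleton, mem_Ioi]
    constructor
    · rintro ⟨h, rfl⟩
      rw [profile_iff_same_cluster hg hf hv] at h
      exact ⟨rfl, not_le.1 h⟩
    · rintro ⟨rfl, h⟩
      rw [profile_iff_same_cluster hg hf hv]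
      exact ⟨not_le.2 h, rfl⟩
  rw [freshIntra, this, card_product, card_singleton, one_mul, Fin.card_Ioi]
  omega

/-- All `L * nI` slots split into fresh intra-cluster, fresh cross-cluster and failed ones, and the
failed ones fill the area under the profile. -/
theorem freshCross_add_band (hgL : ∀ i ∈ Icc 1 nI, g i ≤ L) (hfg : ∀ i ∈ Icc 1 nI, f i ≤ g i)
    (hg : AntitoneOn g (Set.Icc 1 nI)) (hf : AntitoneOn f (Set.Icc 1 nI)) {v : Slot L nI}
    (hv : v ∈ band L nI f g) :
    freshCross (band L nI 0 g) (rowKey L nI f) v + nI +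
      ∑ i ∈ Icc 1 nI, profile f g v i = L * nI + (v.2 + 1) := by
  have hI := freshIntra_band hfg hg hf hv
  have hsum : freshIntra (band L nI 0 g) (rowKey L nI f) v +
      freshCross (band L nI 0 g) (rowKey L nI f) v +
      #(failedUpTo (band L nI 0 g) (rowKey L nI f) v) = L * nI := by
    have h1 := Finset.card_filter_add_card_filter_not (s := (univ : Finset (Slot L nI)))
      (fun s => s ∈ failedUpTo (band L nI 0 g) (rowKey L nI f) v)
    have h2 := Finset.card_filter_add_card_filter_not
      (s := univ.filter fun s => s ∉ failedUpTo (band L nI 0 g) (rowKey L nI f) v)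
      (fun s => s.1 = v.1)
    rw [filter_filter, filter_filter] at h2
    simp only [filter_univ_mem, card_univ, Fintype.card_prod, Fintype.card_fin] at h1
    simp only [freshIntra, freshCross, ne_eq]
    omega
  rw [failedUpTo_band hfg hv, card_band (profile_le hgL hfg v)] at hsum
  simp only [Pi.zero_apply, Nat.sub_zero] at hsum
  have := v.2.2
  omega

theorem sum_profile (hl : ∑ i ∈ Icc 1 nI, f i = l) (v : Slot L nI) :
    ∑ i ∈ Icc 1 nI, (profile f g v i : ℤ) =
      l + ∑ i ∈ Icc 1 (v.2 : ℕ), ((g i : ℤ) - f i) + (v.1 + 1 - f (v.2 + 1)) := by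
  have hv := v.2.2
  rw [← hl]
  have hsub : Icc 1 ((v.2 : ℕ) + 1) ⊆ Icc 1 nI := Icc_subset_Icc_right hv
  have h : ∑ i ∈ Icc 1 nI, ((profile f g v i : ℤ) - f i) =
      ∑ i ∈ Icc 1 (v.2 : ℕ), ((g i : ℤ) - f i) + (v.1 + 1 - f (v.2 + 1)) := by
    rw [← Finset.sum_subset hsub, Finset.sum_Icc_succ_top (by omega)]
    · congr 1
      · refine Finset.sum_congr rfl fun i hi => ?_
        rw [profile, if_pos (mem_Icc.1 hi).2]
      · simp [profile]
    · intro i hi hi'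
      rw [mem_Icc] at hi hi'
      rw [profile, if_neg (by omega), if_neg (by omega), sub_self]
  rw [Finset.sum_sub_distrib] at h
  push_cast
  linarith

end Young

/-! ### From the count of files to the bound on the rate -/

section Bound

variable {L nI k l Lc : ℕ} {α γI γc R : ℝ} {f g : ℕ → ℕ}

theorem le_of_isAchievable (hL : 2 ≤ L) (hnI : 2 ≤ nI) (hkn : k < L * nI)
    (hgL : ∀ i ∈ Icc 1 nI, g i ≤ L) (hfg : ∀ i ∈ Icc 1 nI, f i ≤ g i)
    (hg : AntitoneOn g (Set.Icc 1 nI)) (hf : AntitoneOn f (Set.Icc 1 nI))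
    (hfLc : ∀ i ∈ Icc 1 nI, f i ≤ Lc) (hgk : ∑ i ∈ Icc 1 nI, g i = k)
    (hfl : ∑ i ∈ Icc 1 nI, f i = l) (hR : IsAchievable L nI k l Lc α γI γc R) :
    R ≤ ∑ i ∈ Icc 1 nI, ∑ j ∈ Icc (f i + 1) (g i),
      min (x nI i * γI + (1 - (((l : ℝ) - i) +
        ((∑ m ∈ Icc 1 (i - 1), ((g m : ℝ) - f m)) + j - f i)) / ((L : ℝ) * nI - nI)) * γc) α := by
  obtain ⟨C, u, hu, ha, hbI, hbc, hrec, hsec, hM⟩ := hR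
  have hfL : ∀ i ∈ Icc 1 nI, f i ≤ L := fun i hi => (hfg i hi).trans (hgL i hi)
  have hV : #(band L nI 0 g) = k := by simpa [hgk] using card_band (lo := 0) hgL
  have hE : #(band L nI 0 f) = l := by simpa [hfl] using card_band (lo := 0) hfL
  have hEV : band L nI 0 f ⊆ band L nI 0 g := by
    intro s hs
    rw [mem_band] at hs ⊢
    exact ⟨hs.1, hs.2.trans_le (hfg _ (by simp))⟩
  have hdiff : band L nI 0 g \ band L nI 0 f = band L nI f g := by
    ext s
    simp only [mem_sdiff, mem_band, Pi.zero_apply, zero_le, true_and]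
    omega
  -- The filler slot for times that are not keys exists because `k < n`.
  obtain ⟨d, hd⟩ : ∃ d, d ∉ band L nI 0 g := by
    by_contra! h
    have := Finset.card_eq_of_equiv_fin (s := (univ : Finset (Slot L nI)))
      ((Equiv.subtypeUnivEquiv (by simp)).trans finProdFinEquiv)
    rw [← Finset.eq_univ_iff_forall.2 h] at this
    omega
  have hclusters : #((band L nI 0 f).image Prod.fst) ≤ Lc := by
    rw [← Finset.card_map Fin.valEmbedding]
    refine (Finset.card_le_card (t := Finset.range Lc) ?_).trans (Finset.card_range _).le
    intro c hc
    simp only [mem_map, mem_image, Fin.valEmbedding_apply, mem_band] at hc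
    obtain ⟨_, ⟨s, ⟨_, hs⟩, rfl⟩, rfl⟩ := hc
    exact mem_range.2 (hs.trans_le (hfLc _ (by simp)))
  have hcard := card_files_le C hrec hsec (rowKey_injective f) hV hd hEV hE.le hclusters
  rw [hdiff] at hcard
  -- There is at least one file, so no factor vanishes and logarithms may be split.
  have hpos := Finset.prod_ne_zero_iff.1 (C.M_pos.trans_le hcard).ne'
  have hL' : (2 : ℝ) ≤ L := by exact_mod_cast hL
  have hnI' : (2 : ℝ) ≤ nI := by exact_mod_cast hnI
  have hD : (0 : ℝ) < (L : ℝ) * nI - nI := by nlinarith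
  have hlog : R * u ≤ ∑ v ∈ band L nI f g,
      Real.logb 2 (freshSize C (band L nI 0 g) (rowKey L nI f) v) := by
    rw [← hM, ← Real.logb_prod _ _ fun v hv => Nat.cast_ne_zero.2 (hpos v hv)]
    refine Real.logb_le_logb_of_le one_lt_two (by exact_mod_cast C.M_pos) ?_
    exact_mod_cast hcard
  refine le_of_mul_le_mul_right (hlog.trans ?_) hu
  rw [← sum_band hgL (fun i j : ℕ => min (x nI i * γI + (1 - (((l : ℝ) - i) +
    ((∑ m ∈ Icc 1 (i - 1), ((g m : ℝ) - f m)) + j - f i)) / ((L : ℝ) * nI - nI)) * γc) α),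
    Finset.sum_mul]
  refine Finset.sum_le_sum fun v hv => ?_
  have hsize := Nat.pos_of_ne_zero (hpos v hv)
  have hsize' : (0 : ℝ) < freshSize C (band L nI 0 g) (rowKey L nI f) v := by exact_mod_cast hsize
  rw [← div_le_iff₀ hu]
  refine le_min ?_ ?_ <;> rw [div_le_iff₀ hu]
  · have hle := min_le_right C.a (C.bI ^ freshIntra (band L nI 0 g) (rowKey L nI f) v *
      C.bc ^ freshCross (band L nI 0 g) (rowKey L nI f) v)
    have hne := (hsize.trans_le hle).ne'
    rw [mul_ne_zero_iff] at hne
    refine (Real.logb_le_logb_of_le one_lt_two hsize' (Nat.cast_le.2 hle)).trans ?_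
    push_cast
    rw [Real.logb_mul (by exact_mod_cast hne.1) (by exact_mod_cast hne.2), Real.logb_pow,
      Real.logb_pow]
    have hA : (freshIntra (band L nI 0 g) (rowKey L nI f) v : ℝ) = nI - (v.2 + 1) := by
      rw [freshIntra_band hfg hg hf hv, Nat.cast_sub v.2.2]
      push_cast
      ring
    have hB : (freshCross (band L nI 0 g) (rowKey L nI f) v : ℝ) = (L : ℝ) * nI - nI -
        (((l : ℝ) - ((v.2 + 1 : ℕ) : ℝ)) + ((∑ m ∈ Icc 1 ((v.2 : ℕ) + 1 - 1), ((g m : ℝ) - f m)) +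
          ((v.1 + 1 : ℕ) : ℝ) - f (v.2 + 1))) := by
      have h1 := freshCross_add_band hgL hfg hg hf hv
      have h2 := sum_profile (g := g) hfl v
      have h1' : (freshCross (band L nI 0 g) (rowKey L nI f) v : ℝ) + nI +
          ∑ i ∈ Icc 1 nI, (profile f g v i : ℝ) = L * nI + (v.2 + 1) := by exact_mod_cast h1
      have h2' : ∑ i ∈ Icc 1 nI, (profile f g v i : ℝ) =
          l + ∑ i ∈ Icc 1 (v.2 : ℕ), ((g i : ℝ) - f i) + (v.1 + 1 - f (v.2 + 1)) := by
        exact_mod_cast h2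
      rw [Nat.add_sub_cancel]
      push_cast
      linarith
    have hI := mul_le_mul_of_nonneg_left hbI
      (Nat.cast_nonneg (α := ℝ) (freshIntra (band L nI 0 g) (rowKey L nI f) v))
    have hc := mul_le_mul_of_nonneg_left hbc
      (Nat.cast_nonneg (α := ℝ) (freshCross (band L nI 0 g) (rowKey L nI f) v))
    refine (add_le_add hI hc).trans (le_of_eq ?_)
    rw [hA, hB, x]
    have : (nI : ℝ) - 1 ≠ 0 := by linarith
    have := hD.ne'
    push_cast
    generalize (L : ℝ) * nI - nI = D at *
    field_simp
  · exact (Real.logb_le_logb_of_le one_lt_two hsize' (Nat.cast_le.2 (min_le_left _ _))).trans ha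

end Bound

/-! ### The concrete step functions `f` and `g` -/

section Profiles

/-- The step function with value `A` up to `r`, then `B` on `a` places, then `b` once, then `0`. -/
def steps (r a A B b i : ℕ) : ℕ :=
  if i ≤ r then A else if i ≤ r + a then B else if i = r + a + 1 then b else 0

theorem steps_antitone {r a A B b : ℕ} (hBA : B ≤ A) (hb : b ≤ B) :
    Antitone (steps r a A B b) := by
  intro i j hij
  unfold steps
  split_ifs <;> omega

theorem sum_steps (r a A B b n : ℕ) : ∑ i ∈ Icc 1 n, steps r a A B b i =
    min n r * A + min (n - r) a * B + if r + a < n then b else 0 := by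
  induction n with
  | zero => simp
  | succ n ih =>
    rw [Finset.sum_Icc_succ_top (by omega), ih, steps]
    rcases lt_or_ge n r with h | h
    · rw [if_pos (show n + 1 ≤ r by omega), if_neg (show ¬r + a < n by omega),
        if_neg (show ¬r + a < n + 1 by omega), min_eq_left h.le,
        min_eq_left (show n + 1 ≤ r by omega), Nat.sub_eq_zero_of_le h.le, Nat.sub_eq_zero_of_le h]
      ring
    rw [if_neg (show ¬n + 1 ≤ r by omega), min_eq_right h, min_eq_right (show r ≤ n + 1 by omega)]
    rcases lt_or_ge n (r + a) with h' | h'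
    · rw [if_pos (show n + 1 ≤ r + a by omega), if_neg (by omega), if_neg (by omega),
        min_eq_left (by omega), min_eq_left (by omega), Nat.sub_add_comm h]
      ring
    · rw [if_neg (show ¬n + 1 ≤ r + a by omega), if_pos (show r + a < n + 1 by omega),
        min_eq_right (by omega), min_eq_right (by omega)]
      rcases h'.eq_or_lt with h'' | h''
      · simp [h'']
      · rw [if_pos h'', if_neg (by omega), add_zero]

variable {L nI k l Lc : ℕ}

theorem g_eq_steps {i : ℕ} (hi : i ∈ Icc 1 nI) :
    g nI k i = steps (k % nI) nI (k / nI + 1) (k / nI) 0 i := by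
  rw [mem_Icc] at hi
  unfold g steps
  split_ifs <;> omega

theorem f₁_eq_steps : f₁ l Lc = steps 0 (l / Lc) Lc Lc (l % Lc) := by
  funext i
  unfold f₁ steps
  rw [Nat.mod_def]
  generalize l / Lc = d
  split_ifs <;> omega

theorem f₂_eq_steps (hl : l ≤ k % nI * (k / nI + 1)) : f₂ nI k l =
    steps (l / (k / nI + 1)) 0 (k / nI + 1) (k / nI + 1) (l % (k / nI + 1)) := by
  have := Nat.mod_def l (k / nI + 1)
  have := Nat.div_le_of_le_mul (Nat.mul_comm _ _ ▸ hl)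
  funext i
  unfold f₂ g steps
  split_ifs <;> omega

theorem f₃_eq_steps : f₃ nI k l = steps (k % nI) (l' nI k l / (k / nI)) (k / nI + 1) (k / nI)
    (l' nI k l % (k / nI)) := by
  funext i
  unfold f₃ g steps
  rw [Nat.mod_def (l' nI k l)]
  generalize l' nI k l / (k / nI) = d
  split_ifs <;> omega

theorem g_antitone : Antitone (g nI k) := by
  intro i j hij
  unfold g
  split_ifs <;> omega

theorem g_le_succ (i : ℕ) : g nI k i ≤ k / nI + 1 := by
  unfold g
  split_ifs <;> omega

theorem le_g (i : ℕ) : k / nI ≤ g nI k i := by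
  unfold g
  split_ifs <;> omega

theorem sum_g (hnI : 0 < nI) : ∑ i ∈ Icc 1 nI, g nI k i = k := by
  have hr := Nat.mod_lt k hnI
  rw [Finset.sum_congr rfl fun i hi => g_eq_steps hi, sum_steps, if_neg (by omega),
    min_eq_right hr.le, min_eq_left (by omega), mul_add, add_zero, add_right_comm, ← add_mul,
    Nat.add_sub_cancel' hr.le, mul_one, add_comm]
  exact Nat.mod_add_div ..

/-- All three cases are step functions, so `steps_antitone` and `sum_steps` apply. If `Lc ≤ q`, then
`f ≤ Lc ≤ q ≤ g`; otherwise `f ≤ g ≤ q + 1 ≤ Lc`. -/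
theorem f_spec (hnI : 0 < nI) (hLc : 1 ≤ Lc) (hlk : l ≤ k) (hl : l ≤ nI * Lc) :
    Antitone (f nI k l Lc) ∧ (∀ i ∈ Icc 1 nI, f nI k l Lc i ≤ g nI k i) ∧
      (∀ i ∈ Icc 1 nI, f nI k l Lc i ≤ Lc) ∧ ∑ i ∈ Icc 1 nI, f nI k l Lc i = l := by
  have hr := Nat.mod_lt k hnI
  have hk := Nat.mod_add_div k nI
  unfold f
  split_ifs with h1 h2
  · have hrem := Nat.mod_lt l hLc
    have hdm := Nat.mod_add_div l Lc
    have hdiv : l / Lc ≤ nI := Nat.div_le_of_le_mul (Nat.mul_comm _ _ ▸ hl)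
    have hLc : ∀ i, f₁ l Lc i ≤ Lc := by
      intro i
      rw [f₁_eq_steps, steps]
      split_ifs <;> omega
    refine ⟨?_, fun i _ => (hLc i).trans (h1.trans (le_g i)), fun i _ => hLc i, ?_⟩
    · rw [f₁_eq_steps]
      exact steps_antitone le_rfl hrem.le
    · rw [f₁_eq_steps, sum_steps, Nat.sub_zero, min_eq_right hdiv, min_eq_right (Nat.zero_le _),
        zero_mul, zero_add, zero_add, mul_comm]
      -- If the full steps already occupy all `nI` places, the remainder step falls outside the
      -- range, but `l ≤ nI * Lc` forces the remainder to be zero.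
      split_ifs with h
      · omega
      · rw [le_antisymm hdiv (not_lt.1 h), mul_comm Lc] at hdm
        rw [le_antisymm hdiv (not_lt.1 h), mul_comm Lc]
        omega
  · have hrem : l % (k / nI + 1) < k / nI + 1 := Nat.mod_lt l (k / nI).succ_pos
    have hdm := Nat.mod_add_div l (k / nI + 1)
    have hdiv := Nat.div_le_of_le_mul (Nat.mul_comm _ _ ▸ h2)
    have hfg : ∀ i, f₂ nI k l i ≤ g nI k i := by
      intro i
      rw [f₂_eq_steps h2, steps, g]
      rcases hdiv.eq_or_lt with h | h
      · rw [h, mul_comm] at hdm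
        split_ifs <;> omega
      · split_ifs <;> omega
    refine ⟨?_, fun i _ => hfg i, fun i _ => ((hfg i).trans (g_le_succ i)).trans (by omega), ?_⟩
    · rw [f₂_eq_steps h2]
      exact steps_antitone le_rfl hrem.le
    · rw [f₂_eq_steps h2, sum_steps, min_eq_right (hdiv.trans hr.le),
        min_eq_right (Nat.zero_le _), zero_mul, add_zero, add_zero, if_pos (by omega), mul_comm]
      omega
  · have hql : l' nI k l ≤ k / nI * (nI - k % nI) := by
      rw [Nat.mul_sub, mul_comm (k / nI) nI, mul_comm (k / nI)]
      rw [l', mul_add]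
      omega
    -- If `q = 0`, then `k = r`, and `l > r` would contradict `l ≤ k`.
    have hq : 0 < k / nI := by
      rcases Nat.eq_zero_or_pos (k / nI) with h | h
      · rw [h] at h2 hk
        omega
      · exact h
    have hrem := Nat.mod_lt (l' nI k l) hq
    have hdm := Nat.mod_add_div (l' nI k l) (k / nI)
    have hdiv := Nat.div_le_of_le_mul hql
    have hl' : l' nI k l + k % nI * (k / nI + 1) = l := Nat.sub_add_cancel (not_le.1 h2).le
    have hfg : ∀ i, f₃ nI k l i ≤ g nI k i := by
      intro i
      rw [f₃_eq_steps, steps, g]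
      split_ifs <;> omega
    refine ⟨?_, fun i _ => hfg i, fun i _ => ((hfg i).trans (g_le_succ i)).trans (by omega), ?_⟩
    · rw [f₃_eq_steps]
      exact steps_antitone (Nat.le_succ _) hrem.le
    · rw [f₃_eq_steps, sum_steps, min_eq_right hr.le, min_eq_right hdiv,
        mul_comm (l' nI k l / (k / nI))]
      split_ifs with h
      · omega
      · have e : l' nI k l / (k / nI) = nI - k % nI := by omega
        rw [e] at hdm ⊢
        omega

end Profiles

end ClusteredStorage

theorem theorem2 (L nI k l Lc : ℕ) (α γI γc : ℝ)
    (hL : 2 ≤ L) (hnI : 2 ≤ nI) (hk : 1 ≤ k) (hkn : k < L * nI)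
    (hLc : 1 ≤ Lc) (hLcL : Lc ≤ L) (hlk : l ≤ k) (hl : l ≤ nI * Lc)
    (hα : 0 ≤ α) (hγI : 0 ≤ γI) (hγc : 0 ≤ γc) :
    ClusteredStorage.secrecyCapacity L nI k l Lc α γI γc ≤
      ((∑ i ∈ Finset.Icc 1 nI,
        ∑ j ∈ Finset.Icc (ClusteredStorage.f nI k l Lc i + 1) (ClusteredStorage.g nI k i),
          min (ClusteredStorage.x nI i * γI + ClusteredStorage.yStar L nI k l Lc i j * γc) α : ℝ) :
        EReal) := by
  obtain ⟨hanti, hfg, hfLc, hfl⟩ :=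
    ClusteredStorage.f_spec (l := l) (k := k) (by omega : 0 < nI) hLc hlk hl
  have hq : k / nI < L := Nat.div_lt_of_lt_mul (Nat.mul_comm _ _ ▸ hkn)
  refine iSup₂_le fun R hR => EReal.coe_le_coe_iff.2 ?_
  exact ClusteredStorage.le_of_isAchievable hL hnI hkn
    (fun i _ => (ClusteredStorage.g_le_succ i).trans hq) hfg
    (ClusteredStorage.g_antitone.antitoneOn _) (hanti.antitoneOn _) hfLc
    (ClusteredStorage.sum_g (by omega)) hfl hR
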